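/- Let $K\ge 0$ be an integer; transmitters $1,\dots,K$ are source nodes and transmitter $K+1$ is a relay. Fix complex gains $g_{\ell\mathsf D}$ ($1\le\ell\le K+1$) to the destination and $g_{\ell\mathsf R}$ ($1\le \ell\le K$) to the relay, a noise variance $N>0$, powers $P_1,\dots,P_{K+1}\ge 0$, and a function $d_{\max}:\mathbb N\to\mathbb N$. There are real numbers $\epsilon_n$, $n\ge1$, depending only on these data, such that $\epsilon_n\to0$ as $n\to\infty$ whenever $d_{\max}(n)/n\to0$, and such that the following holds for every block length $n\ge 1$. Let $(U_1[i],\dots,U_K[i])$, $0\le i<n$, be i.i.d. tuples with an arbitrary joint distribution on a product of finite alphabets $\mathcal U_1\times\dots\times\mathcal U_K$, and let $Z_{\mathsf D}[i], Z_{\mathsf R}[i]$, $0\le i<n+d_{\max}(n)$, be i.i.d. circularly symmetric complex Gaussian $\mathcal{CN}(0,N)$ noises, independent of each other and of the sources. Let delays $d_1,\dots,d_{K+1}\in\{0,1,\dots,d_{\max}(n)\}$ be given. For $\ell\le K$ the input is $X_\ell^n=(X_\ell[0],\dots,X_\ell[n-1])=f_\ell(U_\ell[0],\dots,U_\ell[n-1])$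 for an arbitrary encoder $f_\ell:\mathcal U_\ell^n\to\mathbb C^n$; the relay receives $$Y_{\mathsf R}[i]=\sum_{\ell=1}^{K}g_{\ell\mathsf R}X_\ell[i-d_\ell]+Z_{\mathsf R}[i],\qquad 0\le i<n+d_{\max}(n),$$ and sends $X_{K+1}[i]=f_{K+1,i}(Y_{\mathsf R}[0],\dots,Y_{\mathsf R}[i-1])$, $0\le i<n$, for arbitrary measurable functions $f_{K+1,i}$ ($X_{K+1}[0]$ is a constant). Here and below $X_\ell[j]=0$ for $j\notin\{0,\dots,n-1\}$. Assume the power constraints $\mathbb E\big[\frac1n\sum_{i=0}^{n-1}|X_\ell[i]|^2\big]\le P_\ell$ for $\ell=1,\dots,K+1$. For $S\subseteq\{1,\dots,K+1\}$ write $X_S^n=(X_\ell^n)_{\ell\in S}$ and define the destination outputs of the sliced channel and of the sliced cyclic channel by $$Y_{\mathsf D(S)}[i]=\sum_{\ell\in S}g_{\ell\mathsf D}X_\ell[i-d_\ell]+Z_{\mathsf D}[i],\quad 0\le i<n+d_{\max}(n),$$ $$\tilde Y_{\mathsf D(S)}[i]=\sum_{\ell\in S}g_{\ell\mathsf D}X_\ell[(i-d_\ell)\bmod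 n]+Z_{\mathsf D}[i],\quad 0\le i<n.$$ Then, for every $S\subseteq\{1,\dots,K+1\}$, both mutual informations below (for the given delays) are finite and $$\frac1n\left|I\big(X_S^n;Y_{\mathsf D(S)}^{\,n+d_{\max}(n)}\big)-I\big(X_S^n;\tilde Y_{\mathsf D(S)}^{\,n}\big)\right|\le\epsilon_n .$$ In particular $\epsilon_n$ does not depend on the delays. -/

import Mathlib

open MeasureTheory ProbabilityTheory Filter Topology
open scoped ENNReal NNReal

namespace TAMARC

/-- Mutual information `I(X; Y)` (in nats, with values in `[0, ∞]`) of two random variables on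
`(Ω, μ)`: the Kullback-Leibler divergence of their joint law from the product of the marginals. -/
noncomputable def mutualInfo {Ω 𝓧 𝓨 : Type*} [MeasurableSpace Ω] [MeasurableSpace 𝓧]
    [MeasurableSpace 𝓨] (X : Ω → 𝓧) (Y : Ω → 𝓨) (μ : Measure Ω) : ℝ≥0∞ :=
  InformationTheory.klDiv (μ.map fun ω => (X ω, Y ω)) ((μ.map X).prod (μ.map Y))

/-- The circularly symmetric complex Gaussian law `CN(0, N)`: independent real and imaginary
parts, each centred Gaussian of variance `N / 2`. -/
noncomputable def complexGaussian (N : ℝ≥0) : Measure ℂ :=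
  ((gaussianReal 0 (N / 2)).prod (gaussianReal 0 (N / 2))).map
    fun z : ℝ × ℝ => (⟨z.1, z.2⟩ : ℂ)

/-- Joint law of the source block and the two noise blocks: the `n` source tuples are i.i.d. with
probability mass function `p`, the `m` noise samples at the destination and the `m` noise samples
at the relay are i.i.d. `CN(0, N)`, and the three blocks are independent. -/
noncomputable def blockLaw {K : ℕ} {A : Fin K → Type*} [∀ ℓ, MeasurableSpace (A ℓ)]
    (p : PMF (∀ ℓ, A ℓ)) (N : ℝ≥0) (n m : ℕ) :
    Measure ((Fin n → ∀ ℓ, A ℓ) × (Fin m → ℂ) × (Fin m → ℂ)) :=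
  (Measure.pi fun _ => p.toMeasure).prod
    ((Measure.pi fun _ => complexGaussian N).prod (Measure.pi fun _ => complexGaussian N))

/-- The codebook of a block code of length `n` for `K` sources with alphabets `A ℓ`: each source
encoder maps its block of source letters to a codeword, and the symbol sent by the relay at (its)
time `i` is a function of the relay observations at times `0, …, i - 1`. -/
structure Code (K n : ℕ) (A : Fin K → Type*) where
  enc : ∀ ℓ : Fin K, (Fin n → A ℓ) → Fin n → ℂ
  relay : ∀ i : Fin n, (Fin (i : ℕ) → ℂ) → ℂ
  measurable_relay : ∀ i, Measurable (relay i)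

/-- The codeword `x[0], …, x[n-1]`, extended by zero to all integer times. -/
def zeroExt {n : ℕ} (x : Fin n → ℂ) (j : ℤ) : ℂ :=
  if h : 0 ≤ j ∧ j < (n : ℤ) then x ⟨j.toNat, by omega⟩ else 0

/-- The signal received by the relay at times `0, …, m - 1`. The delay vector `d` is indexed by
all `K + 1` transmitters, of which `Fin.last K` is the relay. -/
noncomputable def relayOutput {K n m : ℕ} (gR : Fin K → ℂ) (d : Fin (K + 1) → ℕ)
    (x : Fin K → Fin n → ℂ) (zR : Fin m → ℂ) (i : Fin m) : ℂ :=
  (∑ ℓ : Fin K, gR ℓ * zeroExt (x ℓ) ((i : ℤ) - (d ℓ.castSucc : ℤ))) + zR i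

/-- The channel inputs `X_ℓ^n` of all `K + 1` transmitters (the relay last) produced by the
codebook `c` from the source block `u` and the relay noise `zR`, for the delays `d`. The relay
observes `n + D` samples. -/
noncomputable def inputs {K n D : ℕ} {A : Fin K → Type*} (c : Code K n A) (gR : Fin K → ℂ)
    (d : Fin (K + 1) → ℕ) (u : Fin n → ∀ ℓ, A ℓ) (zR : Fin (n + D) → ℂ) :
    Fin (K + 1) → Fin n → ℂ :=
  Fin.snoc (α := fun _ => Fin n → ℂ) (fun ℓ => c.enc ℓ fun i => u i ℓ)
    fun i => c.relay i fun j =>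
      relayOutput gR d (fun ℓ => c.enc ℓ fun i => u i ℓ) zR ⟨j, by omega⟩

/-- Destination output of the sliced channel: only transmitters in `S` contribute. -/
noncomputable def slicedOutput {K n D : ℕ} (gD : Fin (K + 1) → ℂ) (S : Finset (Fin (K + 1)))
    (d : Fin (K + 1) → ℕ) (x : Fin (K + 1) → Fin n → ℂ) (zD : Fin (n + D) → ℂ)
    (i : Fin (n + D)) : ℂ :=
  (∑ ℓ ∈ S, gD ℓ * zeroExt (x ℓ) ((i : ℤ) - (d ℓ : ℤ))) + zD i

/-- Destination output of the sliced cyclic channel: the codewords are shifted cyclically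
modulo `n`, and only the times `0, …, n - 1` are observed. -/
noncomputable def cyclicOutput {K n D : ℕ} (gD : Fin (K + 1) → ℂ) (S : Finset (Fin (K + 1)))
    (d : Fin (K + 1) → ℕ) (x : Fin (K + 1) → Fin n → ℂ) (zD : Fin (n + D) → ℂ)
    (i : Fin n) : ℂ :=
  (∑ ℓ ∈ S, gD ℓ * zeroExt (x ℓ) (((i : ℤ) - (d ℓ : ℤ)) % (n : ℤ))) + zD (i.castAdd D)

end TAMARC

/-! Write D for `dmax n`. At times D ≤ i < n no delay reaches across an end of the block, so the
linear and the cyclic channel have literally the same outputs there, noise included. Let m be the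
information that these common outputs carry about X_S. By data processing m is a lower bound for
both mutual informations, so it suffices that the remaining outputs, at most 2D for either channel,
add little to m.

One more output a(X) + W, with fresh noise W of variance N and E|a(X)|² ≤ q, adds at most log(1 +
q/N) (`mutualInfo_gaussian_step`). Differential entropy is avoided: the increment is at most the
divergence of the conditional output law from any fixed reference law, and the reference CN(0, N +
q) gives an explicit log-density. Iteration (`mutualInfo_union_le`) bounds the total increment by ∑
log(1 + q_i/N). Each delayed codeword is read at distinct times, so ∑ q_i ≤ nC with C =
(∑|g_ℓ|²)(∑P_ℓ). Then log(1 + x) ≤ 2√x and Cauchy–Schwarz give the bound 2√(2D·nC/N); division by n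
leaves ε_n = 2√(2(D/n)C/N), where the delays enter only through d_ℓ ≤ D.

The relay is harmless: the inputs are a measurable function of the sources and the relay noise,
hence independent of the destination noise. -/

namespace TAMARC

open InformationTheory

/-! ### Divergence and mutual information -/

/-- Chain rule for the divergence of a joint law from a product measure. -/
lemma klDiv_prod_eq_add {α β : Type*} [MeasurableSpace α] [MeasurableSpace β]
    [StandardBorelSpace β] [Nonempty β] (J : Measure (α × β)) [IsFiniteMeasure J]
    (ν : Measure α) [IsFiniteMeasure ν] (ρ : Measure β) [IsProbabilityMeasure ρ] :
    klDiv J (ν.prod ρ) = klDiv J.fst ν + klDiv J (J.fst.prod ρ) := by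
  -- A product measure is a composition-product with a constant kernel, so disintegrating `J` brings
  -- the kernel chain rule into play.
  have h := klDiv_compProd_eq_add J.fst ν J.condKernel (Kernel.const α ρ)
  rwa [Measure.disintegrate, Measure.compProd_const, Measure.compProd_const] at h

/-- The product of the marginals minimises the divergence among the product measures with a
given first factor. -/
lemma klDiv_map_prod_le {Ω 𝓧 𝓨 : Type*} [MeasurableSpace Ω] [MeasurableSpace 𝓧]
    [MeasurableSpace 𝓨] [StandardBorelSpace 𝓧] [Nonempty 𝓧] {μ : Measure Ω}
    [IsProbabilityMeasure μ] {X : Ω → 𝓧} {Y : Ω → 𝓨} (hX : AEMeasurable X μ)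
    (hY : AEMeasurable Y μ) (Q : Measure 𝓨) [IsProbabilityMeasure Q] :
    mutualInfo X Y μ ≤ klDiv (μ.map fun ω => (X ω, Y ω)) ((μ.map X).prod Q) := by
  have := Measure.isProbabilityMeasure_map hX
  have := Measure.isProbabilityMeasure_map hY
  have := Measure.isProbabilityMeasure_map (hY.prodMk hX)
  have := Measure.isProbabilityMeasure_map (hX.prodMk hY)
  have swap1 : (μ.map fun ω => (X ω, Y ω)).map Prod.swap = μ.map fun ω => (Y ω, X ω) := by
    rw [AEMeasurable.map_map_of_aemeasurable measurable_swap.aemeasurable (hX.prodMk hY)]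
    rfl
  have swap2 : (μ.map fun ω => (Y ω, X ω)).map Prod.swap = μ.map fun ω => (X ω, Y ω) := by
    rw [AEMeasurable.map_map_of_aemeasurable measurable_swap.aemeasurable (hY.prodMk hX)]
    rfl
  have hfst : (μ.map fun ω => (Y ω, X ω)).fst = μ.map Y := Measure.fst_map_prodMk₀ hX
  -- The chain rule splits off the first factor, so Y is swapped to the front: replacing the law of
  -- Y by Q then costs exactly the divergence of that law from Q.
  calc mutualInfo X Y μ
      ≤ klDiv (μ.map fun ω => (Y ω, X ω)) ((μ.map Y).prod (μ.map X)) := by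
        have h := klDiv_map_le (μ.map fun ω => (Y ω, X ω)) ((μ.map Y).prod (μ.map X))
          measurable_swap
        rwa [swap2, Measure.prod_swap] at h
    _ ≤ klDiv (μ.map fun ω => (Y ω, X ω)) (Q.prod (μ.map X)) := by
        rw [klDiv_prod_eq_add _ Q, hfst]
        exact le_add_self
    _ ≤ _ := by
        have h := klDiv_map_le (μ.map fun ω => (X ω, Y ω)) ((μ.map X).prod Q) measurable_swap
        rwa [swap1, Measure.prod_swap] at h

/-- Data processing inequality for the mutual information. -/
lemma mutualInfo_comp_le {Ω 𝓧 𝓨 𝓨' : Type*} [MeasurableSpace Ω] [MeasurableSpace 𝓧]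
    [MeasurableSpace 𝓨] [MeasurableSpace 𝓨'] {μ : Measure Ω}
    [IsProbabilityMeasure μ] {X : Ω → 𝓧} {Y : Ω → 𝓨} (hX : AEMeasurable X μ)
    (hY : AEMeasurable Y μ) {f : 𝓨 → 𝓨'} (hf : Measurable f) :
    mutualInfo X (fun ω => f (Y ω)) μ ≤ mutualInfo X Y μ := by
  have := Measure.isProbabilityMeasure_map hX
  have := Measure.isProbabilityMeasure_map hY
  have := Measure.isProbabilityMeasure_map (hX.prodMk hY)
  have h1 : (μ.map fun ω => (X ω, f (Y ω))) =
      (μ.map fun ω => (X ω, Y ω)).map (Prod.map id f) := by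
    rw [AEMeasurable.map_map_of_aemeasurable (by fun_prop) (hX.prodMk hY)]
    rfl
  have h2 : (μ.map X).prod (μ.map fun ω => f (Y ω)) =
      ((μ.map X).prod (μ.map Y)).map (Prod.map id f) := by
    rw [← Measure.map_prod_map _ _ measurable_id hf, Measure.map_id,
      AEMeasurable.map_map_of_aemeasurable hf.aemeasurable hY]
    rfl
  rw [mutualInfo, h1, h2]
  exact klDiv_map_le _ _ (by fun_prop)

/-- A constant carries no information. -/
lemma mutualInfo_const {Ω 𝓧 𝓨 : Type*} [MeasurableSpace Ω] [MeasurableSpace 𝓧]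
    [MeasurableSpace 𝓨] {μ : Measure Ω} [IsProbabilityMeasure μ] {X : Ω → 𝓧}
    (hX : AEMeasurable X μ) (y : 𝓨) : mutualInfo X (fun _ => y) μ = 0 := by
  have := Measure.isProbabilityMeasure_map hX
  have h := (indepFun_iff_map_prod_eq_prod_map_map hX
    (aemeasurable_const (b := y))).1 (indepFun_const_right X y)
  rw [mutualInfo, h]
  have := Measure.isProbabilityMeasure_map (μ := μ) (aemeasurable_const (b := y))
  exact klDiv_self _

/-- The information carried by an additional output is at most the divergence of its
conditional law from an arbitrary reference law. -/
lemma mutualInfo_prodMk_le {Ω 𝓧 𝓨 𝓩 : Type*} [MeasurableSpace Ω] [MeasurableSpace 𝓧]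
    [MeasurableSpace 𝓨] [MeasurableSpace 𝓩] [StandardBorelSpace 𝓧] [Nonempty 𝓧]
    [StandardBorelSpace 𝓩] [Nonempty 𝓩] {μ : Measure Ω} [IsProbabilityMeasure μ]
    {X : Ω → 𝓧} {Y : Ω → 𝓨} {Z : Ω → 𝓩} (hX : AEMeasurable X μ)
    (hY : AEMeasurable Y μ) (hZ : AEMeasurable Z μ) (ρ : Measure 𝓩) [IsProbabilityMeasure ρ] :
    mutualInfo X (fun ω => (Y ω, Z ω)) μ ≤ mutualInfo X Y μ +
      klDiv (μ.map fun ω => ((X ω, Y ω), Z ω)) ((μ.map fun ω => (X ω, Y ω)).prod ρ) := by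
  have := Measure.isProbabilityMeasure_map hX
  have := Measure.isProbabilityMeasure_map hY
  have := Measure.isProbabilityMeasure_map (hX.prodMk hY)
  have := Measure.isProbabilityMeasure_map ((hX.prodMk hY).prodMk hZ)
  have hfst : (μ.map fun ω => ((X ω, Y ω), Z ω)).fst = μ.map fun ω => (X ω, Y ω) :=
    Measure.fst_map_prodMk₀ hZ
  -- Comparing with the product of the law of Y and ρ, instead of the true joint law of (Y, Z),
  -- makes the chain rule split off (X, Y).
  refine (klDiv_map_prod_le hX (hY.prodMk hZ) ((μ.map Y).prod ρ)).trans ?_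
  have h1 : (μ.map fun ω => (X ω, Y ω, Z ω)) =
      (μ.map fun ω => ((X ω, Y ω), Z ω)).map MeasurableEquiv.prodAssoc := by
    rw [AEMeasurable.map_map_of_aemeasurable (by fun_prop) ((hX.prodMk hY).prodMk hZ)]
    rfl
  rw [h1, ← Measure.prodAssoc_prod]
  refine (klDiv_map_le _ _ (by fun_prop)).trans ?_
  rw [klDiv_prod_eq_add, hfst, mutualInfo]

/-! ### Complex Gaussian laws and the cost of one Gaussian output -/

/-- Density of a Gaussian of variance `v` with respect to a centred Gaussian of
variance `w`. -/
lemma gaussianReal_eq_withDensity_gaussianReal (s : ℝ) {v w : ℝ≥0} (hv : 0 < v) (hw : 0 < w) :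
    gaussianReal s v = (gaussianReal 0 w).withDensity fun x => ENNReal.ofReal
      (Real.exp (Real.log (w / v) / 2 - (x - s) ^ 2 / (2 * v) + x ^ 2 / (2 * w))) := by
  rw [gaussianReal_of_var_ne_zero _ hv.ne', gaussianReal_of_var_ne_zero _ hw.ne',
    ← withDensity_mul _ (measurable_gaussianPDF _ _) (by fun_prop)]
  congr 1
  ext x
  have hv' : (0 : ℝ) < v := hv
  have hw' : (0 : ℝ) < w := hw
  rw [Pi.mul_apply, gaussianPDF, gaussianPDF, ← ENNReal.ofReal_mul (gaussianPDFReal_nonneg _ _ _),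
    gaussianPDFReal, gaussianPDFReal,
    mul_assoc (√(2 * Real.pi * w))⁻¹, ← Real.exp_add, sub_zero]
  have e1 : -x ^ 2 / (2 * (w : ℝ)) +
      (Real.log (w / v) / 2 - (x - s) ^ 2 / (2 * v) + x ^ 2 / (2 * w)) =
      Real.log (w / v) / 2 + -(x - s) ^ 2 / (2 * v) := by ring
  have e2 : Real.exp (Real.log (w / v) / 2) = √(w / v) := by
    rw [← Real.log_sqrt (by positivity), Real.exp_log (by positivity)]
  rw [e1, Real.exp_add, e2, ← mul_assoc, Real.sqrt_div (by positivity),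
    Real.sqrt_mul (x := 2 * Real.pi) (by positivity),
    Real.sqrt_mul (x := 2 * Real.pi) (by positivity)]
  congr 2
  have : √(w : ℝ) ≠ 0 := by positivity
  have : √(v : ℝ) ≠ 0 := by positivity
  field_simp

instance isProbabilityMeasure_complexGaussian (N : ℝ≥0) :
    IsProbabilityMeasure (complexGaussian N) :=
  Measure.isProbabilityMeasure_map
    Complex.measurableEquivRealProd.symm.measurable.aemeasurable

lemma measurable_complex_mk : Measurable fun z : ℝ × ℝ => (⟨z.1, z.2⟩ : ℂ) :=
  Complex.measurableEquivRealProd.symm.measurable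

/-- Logarithm of the density of `CN(s, v)` with respect to `CN(0, w)`. -/
noncomputable def gaussianLogRatio (v w : ℝ) (s z : ℂ) : ℝ :=
  Real.log (w / v) - ‖z - s‖ ^ 2 / v + ‖z‖ ^ 2 / w

lemma measurable_gaussianLogRatio {α : Type*} [MeasurableSpace α] {f g : α → ℂ}
    (hf : Measurable f) (hg : Measurable g) (v w : ℝ) :
    Measurable fun x => gaussianLogRatio v w (f x) (g x) := by
  unfold gaussianLogRatio
  fun_prop

/-- The real and imaginary parts are independent with half the variance each, so the two real
log-densities add up. -/
lemma complexGaussian_map_const_add (s : ℂ) {v w : ℝ≥0} (hv : 0 < v) (hw : 0 < w) :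
    (complexGaussian v).map (fun z => s + z) = (complexGaussian w).withDensity fun z =>
      ENNReal.ofReal (Real.exp (gaussianLogRatio v w s z)) := by
  have hm : Measurable fun z => ENNReal.ofReal (Real.exp (gaussianLogRatio v w s z)) :=
    (measurable_gaussianLogRatio measurable_const measurable_id v w).exp.ennreal_ofReal
  have hshift : (complexGaussian v).map (fun z => s + z) =
      ((gaussianReal s.re (v / 2)).prod (gaussianReal s.im (v / 2))).map
        fun z : ℝ × ℝ => (⟨z.1, z.2⟩ : ℂ) := by
    have h (a : ℝ) : gaussianReal a (v / 2) = (gaussianReal 0 (v / 2)).map (fun x => a + x) := by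
      rw [gaussianReal_map_const_add, zero_add]
    rw [h s.re, h s.im, Measure.map_prod_map _ _ (by fun_prop) (by fun_prop), complexGaussian,
      Measure.map_map (by fun_prop) measurable_complex_mk,
      Measure.map_map measurable_complex_mk (by fun_prop)]
    congr 1
  rw [hshift, gaussianReal_eq_withDensity_gaussianReal s.re (half_pos hv) (half_pos hw),
    gaussianReal_eq_withDensity_gaussianReal s.im (half_pos hv) (half_pos hw),
    prod_withDensity (by fun_prop) (by fun_prop)]
  ext B hB
  rw [Measure.map_apply measurable_complex_mk hB, withDensity_apply _ (measurable_complex_mk hB),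
    withDensity_apply _ hB, complexGaussian, setLIntegral_map hB hm measurable_complex_mk]
  refine lintegral_congr fun z => ?_
  rw [← ENNReal.ofReal_mul (Real.exp_pos _).le, ← Real.exp_add]
  congr 2
  rw [gaussianLogRatio, Complex.sq_norm, Complex.sq_norm, Complex.normSq_apply,
    Complex.normSq_apply]
  have hv' : (0 : ℝ) < v := hv
  have hw' : (0 : ℝ) < w := hw
  have : ((w / 2 : ℝ≥0) : ℝ) / ((v / 2 : ℝ≥0) : ℝ) = w / v := by
    push_cast
    field_simp
  rw [this]
  push_cast
  simp only [Complex.sub_re, Complex.sub_im]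
  field_simp
  ring

lemma integrable_sq_gaussianReal (s : ℝ) (v : ℝ≥0) :
    Integrable (fun x => x ^ 2) (gaussianReal s v) := by
  simpa using (memLp_id_gaussianReal (μ := s) (v := v) 2).integrable_sq

lemma integral_sq_gaussianReal (s : ℝ) (v : ℝ≥0) :
    ∫ x, x ^ 2 ∂gaussianReal s v = s ^ 2 + v := by
  have h := variance_eq_sub (memLp_id_gaussianReal (μ := s) (v := v) 2)
  rw [variance_id_gaussianReal] at h
  simp only [Pi.pow_apply, id, integral_id_gaussianReal] at h
  linarith

/-- Second moment of a shifted complex Gaussian. -/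
lemma complexGaussian_sq_norm_add (s : ℂ) (v : ℝ≥0) :
    Integrable (fun z => ‖s + z‖ ^ 2) (complexGaussian v) ∧
      ∫ z, ‖s + z‖ ^ 2 ∂complexGaussian v = ‖s‖ ^ 2 + v := by
  have hint (a : ℝ) : Integrable (fun x => (a + x) ^ 2) (gaussianReal 0 (v / 2)) := by
    have := integrable_sq_gaussianReal (0 + a) (v / 2)
    rw [← gaussianReal_map_const_add] at this
    exact this.comp_measurable (by fun_prop)
  have hval (a : ℝ) : ∫ x, (a + x) ^ 2 ∂gaussianReal 0 (v / 2) = a ^ 2 + v / 2 := by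
    have := integral_sq_gaussianReal (0 + a) (v / 2)
    rw [← gaussianReal_map_const_add, integral_map (by fun_prop) (by fun_prop)] at this
    simpa using this
  have hsq (z : ℝ × ℝ) : ‖s + (⟨z.1, z.2⟩ : ℂ)‖ ^ 2 = (s.re + z.1) ^ 2 + (s.im + z.2) ^ 2 := by
    rw [Complex.sq_norm, Complex.normSq_apply]
    simp only [Complex.add_re, Complex.add_im]
    ring
  have h1 : Integrable (fun z : ℝ × ℝ => (s.re + z.1) ^ 2)
      ((gaussianReal 0 (v / 2)).prod (gaussianReal 0 (v / 2))) := (hint s.re).comp_fst _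
  have h2 : Integrable (fun z : ℝ × ℝ => (s.im + z.2) ^ 2)
      ((gaussianReal 0 (v / 2)).prod (gaussianReal 0 (v / 2))) := (hint s.im).comp_snd _
  constructor
  · rw [complexGaussian, integrable_map_measure (by fun_prop) measurable_complex_mk.aemeasurable]
    exact (h1.add h2).congr (Eventually.of_forall fun z => (hsq z).symm)
  · rw [complexGaussian, integral_map measurable_complex_mk.aemeasurable (by fun_prop)]
    simp only [hsq]
    rw [integral_add h1 h2, integral_fun_fst (fun x : ℝ => (s.re + x) ^ 2),
      integral_fun_snd (fun x : ℝ => (s.im + x) ^ 2), hval, hval, Complex.sq_norm,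
      Complex.normSq_apply]
    simp
    ring

/-- The divergence of a measure with log-density `g`. -/
lemma klDiv_withDensity_exp {α : Type*} [MeasurableSpace α] (ν : Measure α)
    [IsProbabilityMeasure ν] {g : α → ℝ} (hg : Measurable g)
    [IsProbabilityMeasure (ν.withDensity fun x => ENNReal.ofReal (Real.exp (g x)))]
    (hint : Integrable g (ν.withDensity fun x => ENNReal.ofReal (Real.exp (g x)))) :
    klDiv (ν.withDensity fun x => ENNReal.ofReal (Real.exp (g x))) ν =
      ENNReal.ofReal (∫ x, g x ∂ν.withDensity fun x => ENNReal.ofReal (Real.exp (g x))) := by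
  set m := ν.withDensity fun x => ENNReal.ofReal (Real.exp (g x)) with hm
  have hac : m ≪ ν := withDensity_absolutelyContinuous _ _
  have hllr : llr m ν =ᵐ[m] g := by
    refine hac.ae_le ?_
    filter_upwards [Measure.rnDeriv_withDensity ν hg.exp.ennreal_ofReal] with x hx
    rw [llr, hm, hx, ENNReal.toReal_ofReal (Real.exp_pos _).le, Real.log_exp]
  -- Both measures have mass one, so the mass correction in `klDiv` vanishes.
  rw [klDiv_of_ac_of_integrable hac (hint.congr hllr.symm), integral_congr_ae hllr]
  simp

/-- Density of the joint law of a parameter and the output of an additive Gaussian channel. -/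
lemma gaussian_channel_eq_withDensity {α : Type*} [MeasurableSpace α] (J : Measure α)
    [IsProbabilityMeasure J] {a : α → ℂ} (ha : Measurable a) {v w : ℝ≥0} (hv : 0 < v)
    (hw : 0 < w) :
    (J.prod (complexGaussian v)).map (fun x => (x.1, a x.1 + x.2)) =
      (J.prod (complexGaussian w)).withDensity
        fun x => ENNReal.ofReal (Real.exp (gaussianLogRatio v w (a x.1) x.2)) := by
  have hg : Measurable fun x : α × ℂ => gaussianLogRatio v w (a x.1) x.2 :=
    measurable_gaussianLogRatio (ha.comp measurable_fst) measurable_snd v w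
  have hmap : Measurable fun x : α × ℂ => (x.1, a x.1 + x.2) := by fun_prop
  refine Measure.ext_of_lintegral _ fun f hf => ?_
  have hfm : Measurable fun x : α × ℂ => f (x.1, a x.1 + x.2) := hf.comp hmap
  rw [lintegral_map hf hmap, lintegral_prod _ hfm.aemeasurable,
    lintegral_withDensity_eq_lintegral_mul _ hg.exp.ennreal_ofReal hf,
    lintegral_prod _ (hg.exp.ennreal_ofReal.mul hf).aemeasurable]
  -- For a fixed parameter `p` the channel is a translation of the noise by `a p`.
  refine lintegral_congr fun p => ?_
  have hf' : Measurable fun z => f (p, z) := hf.comp measurable_prodMk_left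
  have hg' : Measurable fun z => ENNReal.ofReal (Real.exp (gaussianLogRatio v w (a p) z)) :=
    (hg.comp measurable_prodMk_left).exp.ennreal_ofReal
  rw [← lintegral_map (f := fun z => f (p, z)) (g := fun z => a p + z) hf' (by fun_prop),
    complexGaussian_map_const_add (a p) hv hw,
    lintegral_withDensity_eq_lintegral_mul _ hg' hf']
  rfl

/-- Power of the output of an additive Gaussian channel. -/
lemma gaussian_channel_sq_norm_le {α : Type*} [MeasurableSpace α] (J : Measure α)
    [IsProbabilityMeasure J] {a : α → ℂ} (ha : Measurable a) (v q : ℝ≥0)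
    (hq : ∫⁻ p, ‖a p‖ₑ ^ 2 ∂J ≤ q) :
    Integrable (fun x : α × ℂ => ‖a x.1 + x.2‖ ^ 2) (J.prod (complexGaussian v)) ∧
      ∫ x : α × ℂ, ‖a x.1 + x.2‖ ^ 2 ∂(J.prod (complexGaussian v)) ≤ v + q := by
  have ha2 : Integrable (fun p => ‖a p‖ ^ 2) J := by
    refine ⟨by fun_prop, ?_⟩
    rw [HasFiniteIntegral]
    simp only [enorm_pow, enorm_norm]
    exact hq.trans_lt ENNReal.coe_lt_top
  have ha2' : ∫ p, ‖a p‖ ^ 2 ∂J ≤ q := by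
    rw [integral_eq_lintegral_of_nonneg_ae (Eventually.of_forall fun p => by positivity)
      (by fun_prop)]
    refine ENNReal.toReal_le_of_le_ofReal q.2 ?_
    simpa [ENNReal.ofReal_pow, ofReal_norm] using hq
  have hsum : Integrable (fun x : α × ℂ => ‖a x.1 + x.2‖ ^ 2) (J.prod (complexGaussian v)) := by
    refine (integrable_prod_iff (by fun_prop)).2
      ⟨Eventually.of_forall fun p => (complexGaussian_sq_norm_add (a p) v).1, ?_⟩
    simp only [norm_pow, norm_norm, (complexGaussian_sq_norm_add _ v).2]
    exact ha2.add (integrable_const _)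
  refine ⟨hsum, ?_⟩
  rw [integral_prod _ hsum]
  simp only [(complexGaussian_sq_norm_add _ v).2]
  rw [integral_add ha2 (integrable_const _)]
  simp only [integral_const, probReal_univ, smul_eq_mul, one_mul]
  linarith

/-- Conditional divergence of the output of an additive Gaussian channel, whose input has power
at most `q`, from a Gaussian of variance `v + q`. -/
lemma klDiv_gaussian_channel_le {α : Type*} [MeasurableSpace α] (J : Measure α)
    [IsProbabilityMeasure J] {a : α → ℂ} (ha : Measurable a) {v : ℝ≥0} (hv : 0 < v) (q : ℝ≥0)
    (hq : ∫⁻ p, ‖a p‖ₑ ^ 2 ∂J ≤ q) :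
    klDiv ((J.prod (complexGaussian v)).map fun x => (x.1, a x.1 + x.2))
      (J.prod (complexGaussian (v + q))) ≤ ENNReal.ofReal (Real.log (1 + q / v)) := by
  obtain ⟨w, hw_def⟩ : ∃ w, w = v + q := ⟨_, rfl⟩
  have hw : 0 < w := hw_def ▸ add_pos_of_pos_of_nonneg hv zero_le
  have hv' : (0 : ℝ) < v := hv
  have hw' : (0 : ℝ) < w := hw
  have hwr : (w : ℝ) = v + q := by rw [hw_def]; rfl
  rw [← hw_def]
  have hg : Measurable fun x : α × ℂ => gaussianLogRatio v w (a x.1) x.2 :=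
    measurable_gaussianLogRatio (ha.comp measurable_fst) measurable_snd v w
  have hmap : Measurable fun x : α × ℂ => (x.1, a x.1 + x.2) := by fun_prop
  have hdens := gaussian_channel_eq_withDensity J ha hv hw
  have hprob := Measure.isProbabilityMeasure_map (μ := J.prod (complexGaussian v))
    hmap.aemeasurable
  obtain ⟨hnoise, hnoise'⟩ : Integrable (fun x : α × ℂ => ‖x.2‖ ^ 2) (J.prod (complexGaussian v)) ∧
      ∫ x : α × ℂ, ‖x.2‖ ^ 2 ∂(J.prod (complexGaussian v)) = v := by
    have h := complexGaussian_sq_norm_add 0 v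
    simp only [zero_add] at h
    refine ⟨h.1.comp_snd J, ?_⟩
    rw [integral_fun_snd (fun z : ℂ => ‖z‖ ^ 2)]
    simpa using h.2
  obtain ⟨hsum, hsum'⟩ := gaussian_channel_sq_norm_le J ha v q hq
  -- Output minus signal is pure noise, so the middle term of the log-ratio has mean exactly 1.
  have hgval (x : α × ℂ) : gaussianLogRatio v w (a x.1) (a x.1 + x.2) =
      (Real.log (w / v) - ‖x.2‖ ^ 2 / v) + ‖a x.1 + x.2‖ ^ 2 / w := by
    rw [gaussianLogRatio, add_sub_cancel_left]
  have hi1 : Integrable (fun x : α × ℂ => Real.log (w / v) - ‖x.2‖ ^ 2 / v)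
      (J.prod (complexGaussian v)) := (integrable_const _).sub (hnoise.div_const _)
  have hint : Integrable (fun x : α × ℂ => gaussianLogRatio v w (a x.1) x.2)
      ((J.prod (complexGaussian v)).map fun x => (x.1, a x.1 + x.2)) := by
    rw [integrable_map_measure hg.aestronglyMeasurable hmap.aemeasurable]
    exact (hi1.add (hsum.div_const _)).congr (Eventually.of_forall fun x => (hgval x).symm)
  have hval : ∫ x : α × ℂ, gaussianLogRatio v w (a x.1) x.2
      ∂((J.prod (complexGaussian v)).map fun x => (x.1, a x.1 + x.2)) ≤
      Real.log (1 + q / v) := by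
    rw [integral_map hmap.aemeasurable hg.aestronglyMeasurable]
    simp only [hgval]
    rw [integral_add hi1 (hsum.div_const _), integral_sub (integrable_const _) (hnoise.div_const _),
      integral_div, integral_div, hnoise', div_self hv'.ne']
    -- With reference variance w = v + q this term is at most 1 and is absorbed by the noise term,
    -- leaving log(w/v).
    have h1 : (∫ x : α × ℂ, ‖a x.1 + x.2‖ ^ 2 ∂(J.prod (complexGaussian v))) / w ≤ 1 := by
      rw [div_le_one hw', hwr]
      exact hsum'
    have h2 : (w : ℝ) / v = 1 + q / v := by
      rw [hwr]
      field_simp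
    rw [h2]
    simp only [integral_const, probReal_univ, smul_eq_mul, one_mul]
    linarith
  rw [hdens] at hprob hint hval ⊢
  rw [klDiv_withDensity_exp _ hg hint]
  exact ENNReal.ofReal_le_ofReal hval

/-! ### Adding outputs one at a time -/

/-- Observing one more output of an additive Gaussian channel, with fresh noise, adds at most
`log (1 + q / v)` to the information. -/
lemma mutualInfo_gaussian_step {Ω 𝓧 𝓨 : Type*} [MeasurableSpace Ω] [MeasurableSpace 𝓧]
    [MeasurableSpace 𝓨] [StandardBorelSpace 𝓧] [Nonempty 𝓧] {μ : Measure Ω}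
    [IsProbabilityMeasure μ] {X : Ω → 𝓧} {Y : Ω → 𝓨} {W : Ω → ℂ} (hX : AEMeasurable X μ)
    (hY : AEMeasurable Y μ) (hW : AEMeasurable W μ) {v : ℝ≥0} (hv : 0 < v)
    (hlaw : μ.map (fun ω => ((X ω, Y ω), W ω)) =
      (μ.map fun ω => (X ω, Y ω)).prod (complexGaussian v))
    {a : 𝓧 → ℂ} (ha : Measurable a) (q : ℝ≥0) (hq : ∫⁻ ω, ‖a (X ω)‖ₑ ^ 2 ∂μ ≤ q) :
    mutualInfo X (fun ω => (Y ω, a (X ω) + W ω)) μ ≤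
      mutualInfo X Y μ + ENNReal.ofReal (Real.log (1 + q / v)) := by
  have hXY := hX.prodMk hY
  have := Measure.isProbabilityMeasure_map hXY
  have haX : AEMeasurable (fun ω => a (X ω)) μ := ha.comp_aemeasurable hX
  refine (mutualInfo_prodMk_le hX hY (haX.add hW) (complexGaussian (v + q))).trans ?_
  gcongr
  have ha' : Measurable fun p : 𝓧 × 𝓨 => a p.1 := ha.comp measurable_fst
  have hmap : Measurable fun x : (𝓧 × 𝓨) × ℂ => (x.1, a x.1.1 + x.2) := by fun_prop
  have h1 : (μ.map fun ω => ((X ω, Y ω), a (X ω) + W ω)) =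
      ((μ.map fun ω => (X ω, Y ω)).prod (complexGaussian v)).map
        fun x => (x.1, a x.1.1 + x.2) := by
    rw [← hlaw, AEMeasurable.map_map_of_aemeasurable hmap.aemeasurable (hXY.prodMk hW)]
    rfl
  have h2 : ∫⁻ p, ‖a p.1‖ₑ ^ 2 ∂(μ.map fun ω => (X ω, Y ω)) ≤ q := by
    rwa [lintegral_map' (by fun_prop) hXY]
  exact h1 ▸ klDiv_gaussian_channel_le _ ha' hv q h2

/-- Under a product measure, a coordinate is independent of any set of other coordinates. -/
lemma map_pi_restrict_eval {ι α : Type*} [Fintype ι] [MeasurableSpace α] (ν : Measure α)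
    [IsProbabilityMeasure ν] {T : Finset ι} {i : ι} (hi : i ∉ T) :
    (Measure.pi fun _ : ι => ν).map (fun z => ((fun j : T => z j), z i)) =
      ((Measure.pi fun _ : ι => ν).map fun z (j : T) => z j).prod ν := by
  classical
  have hind : iIndepFun (fun (j : ι) (z : ι → α) => z j) (Measure.pi fun _ : ι => ν) :=
    iIndepFun_pi (X := fun _ => id) fun _ => aemeasurable_id
  have h1 := hind.indepFun_finset T {i} (by simpa using hi) fun j => measurable_pi_apply j
  have h2 : IndepFun (fun (z : ι → α) (j : T) => z j) (fun z => z i)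
      (Measure.pi fun _ : ι => ν) :=
    h1.comp (φ := id) (ψ := fun y : ({i} : Finset ι) → α => y ⟨i, by simp⟩) measurable_id
      (measurable_pi_apply _)
  rw [(indepFun_iff_map_prod_eq_prod_map_map
    (measurable_pi_iff.2 fun _ => measurable_pi_apply _).aemeasurable
    (measurable_pi_apply i).aemeasurable).1 h2]
  congr 1
  exact (measurePreserving_eval (fun _ : ι => ν) i).map_eq

lemma aemeasurable_output {Ω 𝓧 ι κ : Type*} [MeasurableSpace Ω] [MeasurableSpace 𝓧]
    [Countable κ] {μ : Measure Ω} {X : Ω → 𝓧} {Z : Ω → ι → ℂ} {s : ι → 𝓧 → ℂ}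
    (hX : AEMeasurable X μ) (hZ : AEMeasurable Z μ) (hs : ∀ i, Measurable (s i)) (e : κ → ι) :
    AEMeasurable (fun ω (j : κ) => s (e j) (X ω) + Z ω (e j)) μ :=
  aemeasurable_pi_iff.2 fun j => ((hs (e j)).comp_aemeasurable hX).add (by fun_prop)

/-- Data processing inequality for subfamilies of a family of outputs. -/
lemma mutualInfo_reindex_le {Ω 𝓧 ι κ κ' α : Type*} [MeasurableSpace Ω] [MeasurableSpace 𝓧]
    [MeasurableSpace α] {μ : Measure Ω} [IsProbabilityMeasure μ] {X : Ω → 𝓧} {Y : Ω → ι → α}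
    {e : κ → ι} {e' : κ' → ι} (hX : AEMeasurable X μ)
    (hY : AEMeasurable (fun ω j => Y ω (e' j)) μ) (h : ∀ j, ∃ k, e' k = e j) :
    mutualInfo X (fun ω j => Y ω (e j)) μ ≤ mutualInfo X (fun ω j => Y ω (e' j)) μ := by
  choose k hk using h
  have heq : (fun ω j => Y ω (e j)) = fun ω => (fun y j => y (k j)) (fun j => Y ω (e' j)) := by
    ext ω j
    simp only [hk]
  rw [heq]
  exact mutualInfo_comp_le hX hY (measurable_pi_iff.2 fun j => measurable_pi_apply (k j))

section Channel

variable {Ω 𝓧 ι : Type*} [MeasurableSpace Ω] [MeasurableSpace 𝓧] [Fintype ι] {μ : Measure Ω}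
  [IsProbabilityMeasure μ] {X : Ω → 𝓧} {Z : Ω → ι → ℂ} {v : ℝ≥0} {s : ι → 𝓧 → ℂ}

/-- The input and the outputs in `T` involve only X and the noise coordinates in `T`, which are
jointly independent of coordinate `i`. This is the fresh-noise hypothesis of
`mutualInfo_gaussian_step`. -/
lemma map_prodMk_output_eq_prod (hX : AEMeasurable X μ) (hZ : AEMeasurable Z μ)
    (hlaw : μ.map (fun ω => (X ω, Z ω)) =
      (μ.map X).prod (Measure.pi fun _ => complexGaussian v))
    (hs : ∀ i, Measurable (s i)) {T : Finset ι} {i : ι} (hi : i ∉ T) :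
    μ.map (fun ω => ((X ω, fun j : T => s j (X ω) + Z ω j), Z ω i)) =
      (μ.map fun ω => (X ω, fun j : T => s j (X ω) + Z ω j)).prod (complexGaussian v) := by
  have := Measure.isProbabilityMeasure_map hX
  set R : (ι → ℂ) → (T → ℂ) := fun z j => z j
  set P := Measure.pi fun _ : ι => complexGaussian v
  have hR : Measurable R := by fun_prop
  have := Measure.isProbabilityMeasure_map (μ := P) hR.aemeasurable
  have hXZ := hX.prodMk hZ
  have e1 : μ.map (fun ω => ((X ω, R (Z ω)), Z ω i)) =
      ((μ.map X).prod (P.map R)).prod (complexGaussian v) := by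
    have h : (μ.map fun ω => (X ω, Z ω)).map (Prod.map id fun z => (R z, z i)) =
        (μ.map X).prod ((P.map R).prod (complexGaussian v)) := by
      rw [hlaw, ← Measure.map_prod_map _ _ measurable_id (by fun_prop), Measure.map_id,
        map_pi_restrict_eval _ hi]
    rw [← Measure.prodAssoc_prod,
      AEMeasurable.map_map_of_aemeasurable (by fun_prop) hXZ] at h
    have h' := congrArg (Measure.map MeasurableEquiv.prodAssoc.symm) h
    rw [MeasurableEquiv.map_symm_map, AEMeasurable.map_map_of_aemeasurable (by fun_prop)
      (by fun_prop)] at h'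
    exact h'
  set F : 𝓧 × (T → ℂ) → 𝓧 × (T → ℂ) := fun p => (p.1, fun j : T => s j p.1 + p.2 j) with hF_def
  have hF : Measurable F := by
    refine measurable_fst.prodMk (measurable_pi_iff.2 fun j => ?_)
    exact ((hs j).comp measurable_fst).add (by fun_prop)
  have e2 : μ.map (fun ω => (X ω, R (Z ω))) = (μ.map X).prod (P.map R) := by
    have h := congrArg Measure.fst e1
    rwa [Measure.fst_map_prodMk₀ (by fun_prop), Measure.fst_prod] at h
  have hXR : AEMeasurable (fun ω => (X ω, R (Z ω))) μ := by fun_prop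
  -- `F` turns noise into output, (x, z) ↦ (x, s(x) + z), without touching coordinate `i`.
  have h3 := congrArg (Measure.map (Prod.map F id)) e1
  rw [← Measure.map_prod_map _ _ hF measurable_id, Measure.map_id, ← e2,
    AEMeasurable.map_map_of_aemeasurable hF.aemeasurable hXR,
    AEMeasurable.map_map_of_aemeasurable (by fun_prop) (by fun_prop)] at h3
  exact h3

variable [StandardBorelSpace 𝓧] [Nonempty 𝓧]

/-- The information carried by the outputs in `E`, in addition to those in `T`. -/
lemma mutualInfo_union_le [DecidableEq ι] (hX : AEMeasurable X μ) (hZ : AEMeasurable Z μ)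
    (hv : 0 < v)
    (hlaw : μ.map (fun ω => (X ω, Z ω)) =
      (μ.map X).prod (Measure.pi fun _ => complexGaussian v))
    (hs : ∀ i, Measurable (s i)) {q : ι → ℝ≥0} (T E : Finset ι)
    (hq : ∀ i ∈ E, ∫⁻ ω, ‖s i (X ω)‖ₑ ^ 2 ∂μ ≤ q i) :
    mutualInfo X (fun ω (j : (E ∪ T : Finset ι)) => s j (X ω) + Z ω j) μ ≤
      mutualInfo X (fun ω (j : T) => s j (X ω) + Z ω j) μ +
        ENNReal.ofReal (∑ i ∈ E, Real.log (1 + q i / v)) := by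
  have hY (T : Finset ι) : AEMeasurable (fun ω (j : T) => s j (X ω) + Z ω j) μ :=
    aemeasurable_output hX hZ hs _
  have hlog (i : ι) : 0 ≤ Real.log (1 + q i / v) := Real.log_nonneg (by simp; positivity)
  induction E using Finset.induction_on with
  | empty =>
    rw [Finset.sum_empty, ENNReal.ofReal_zero, add_zero]
    exact mutualInfo_comp_le hX (hY T)
      (f := fun y (j : (∅ ∪ T : Finset ι)) => y ⟨j, by simpa using j.2⟩) (by fun_prop)
  | insert i E hi ih =>
    have ih := ih fun j hj => hq j (Finset.mem_insert_of_mem hj)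
    rw [Finset.sum_insert hi, add_comm (Real.log _),
      ENNReal.ofReal_add (Finset.sum_nonneg fun j _ => hlog j) (hlog i), ← add_assoc]
    have hmem (j : (insert i E ∪ T : Finset ι)) : (j : ι) ∈ insert i (E ∪ T) :=
      (Finset.ext_iff.1 (Finset.insert_union i E T) j).1 j.2
    -- `E` and `T` may overlap; an output already observed adds nothing.
    by_cases hiT : i ∈ E ∪ T
    · refine le_trans ?_ (ih.trans le_self_add)
      exact mutualInfo_comp_le hX (hY (E ∪ T))
        (f := fun y (j : (insert i E ∪ T : Finset ι)) => y ⟨j,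
          (Finset.mem_insert.1 (hmem j)).elim (fun h => by rwa [h]) id⟩) (by fun_prop)
    · have step := mutualInfo_gaussian_step hX (hY (E ∪ T)) (by fun_prop) hv
        (map_prodMk_output_eq_prod hX hZ hlaw hs hiT) (hs i) (q i)
        (hq i (Finset.mem_insert_self i E))
      refine le_trans ?_ (step.trans (by gcongr))
      set f : ((E ∪ T : Finset ι) → ℂ) × ℂ → ((insert i E ∪ T : Finset ι) → ℂ) :=
        fun y j => if h : (j : ι) ∈ E ∪ T then y.1 ⟨j, h⟩ else y.2 with hf_def
      have hf : Measurable f := by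
        refine measurable_pi_iff.2 fun j => ?_
        by_cases h : (j : ι) ∈ E ∪ T
        · simp only [hf_def, h, dite_true]
          fun_prop
        · simp only [hf_def, h, dite_false]
          fun_prop
      have heq : (fun ω (j : (insert i E ∪ T : Finset ι)) => s j (X ω) + Z ω j) =
          fun ω => f (fun j => s j (X ω) + Z ω j, s i (X ω) + Z ω i) := by
        ext ω j
        by_cases h : (j : ι) ∈ E ∪ T
        · simp only [hf_def]
          rw [dif_pos h]
        · simp only [hf_def]
          rw [dif_neg h, (Finset.mem_insert.1 (hmem j)).resolve_right h]
      rw [heq]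
      exact mutualInfo_comp_le hX
        ((hY (E ∪ T)).prodMk (((hs i).comp_aemeasurable hX).add (by fun_prop))) hf

end Channel

/-! ### Logarithm and energy estimates -/

/-- From 1 + x ≤ (1 + √x)². Coarser than concavity of the logarithm, but it leads to a bound with no
division by the number of positions, which may be zero. -/
lemma log_one_add_le_two_mul_sqrt {x : ℝ} (hx : 0 ≤ x) : Real.log (1 + x) ≤ 2 * √x := by
  have h0 := Real.sqrt_nonneg x
  have h1 : 1 + x ≤ (1 + √x) ^ 2 := by nlinarith [Real.sq_sqrt hx]
  calc Real.log (1 + x) ≤ Real.log ((1 + √x) ^ 2) := Real.log_le_log (by positivity) h1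
    _ = 2 * Real.log (1 + √x) := by rw [Real.log_pow]; norm_num
    _ ≤ 2 * √x := by linarith [Real.log_le_sub_one_of_pos (show 0 < 1 + √x by positivity)]

lemma sum_log_one_add_le {ι : Type*} (E : Finset ι) (x : ι → ℝ) (hx : ∀ i, 0 ≤ x i) :
    ∑ i ∈ E, Real.log (1 + x i) ≤ 2 * √(E.card * ∑ i ∈ E, x i) := by
  calc ∑ i ∈ E, Real.log (1 + x i) ≤ ∑ i ∈ E, 2 * √(x i) :=
        Finset.sum_le_sum fun i _ => log_one_add_le_two_mul_sqrt (hx i)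
    _ = 2 * ∑ i ∈ E, √(x i) := by rw [Finset.mul_sum]
    _ ≤ 2 * √(E.card * ∑ i ∈ E, x i) := by
        gcongr
        refine Real.le_sqrt_of_sq_le ?_
        refine sq_sum_le_card_mul_sum_sq.trans_eq ?_
        simp only [Real.sq_sqrt (hx _)]

/-- An injective `φ` reads each codeword symbol at most once, and every other time reads zero. -/
lemma sum_sq_enorm_zeroExt_le {κ : Type*} {n : ℕ} (x : Fin n → ℂ) (E : Finset κ) (φ : κ → ℤ)
    (hφ : Set.InjOn φ E) : ∑ i ∈ E, ‖zeroExt x (φ i)‖ₑ ^ 2 ≤ ∑ j, ‖x j‖ₑ ^ 2 := by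
  classical
  have h1 : ∑ i ∈ E, ‖zeroExt x (φ i)‖ₑ ^ 2 = ∑ k ∈ E.image φ, ‖zeroExt x k‖ₑ ^ 2 :=
    (Finset.sum_image (f := fun k => ‖zeroExt x k‖ₑ ^ 2) hφ).symm
  have h2 : ∑ j, ‖x j‖ₑ ^ 2 =
      ∑ k ∈ Finset.univ.image (fun j : Fin n => (j : ℤ)), ‖zeroExt x k‖ₑ ^ 2 := by
    rw [Finset.sum_image fun i _ j _ h => by
      have : (i : ℤ) = j := h
      exact Fin.ext (by omega)]
    refine Finset.sum_congr rfl fun j _ => ?_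
    simp [zeroExt]
  rw [h1, h2]
  refine Finset.sum_le_sum_of_ne_zero fun k _ hk => ?_
  by_cases h : 0 ≤ k ∧ k < n
  · exact Finset.mem_image.2 ⟨⟨k.toNat, by omega⟩, Finset.mem_univ _, by simp [h.1]⟩
  · simp [zeroExt, h] at hk

lemma sq_enorm_sum_mul_le {κ : Type*} (S : Finset κ) (g y : κ → ℂ) :
    ‖∑ ℓ ∈ S, g ℓ * y ℓ‖ₑ ^ 2 ≤ (∑ ℓ ∈ S, ‖g ℓ‖ₑ ^ 2) * ∑ ℓ ∈ S, ‖y ℓ‖ₑ ^ 2 := by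
  have h : ‖∑ ℓ ∈ S, g ℓ * y ℓ‖₊ ^ 2 ≤ (∑ ℓ ∈ S, ‖g ℓ‖₊ ^ 2) * ∑ ℓ ∈ S, ‖y ℓ‖₊ ^ 2 := by
    refine le_trans ?_ (Finset.sum_mul_sq_le_sq_mul_sq S _ _)
    gcongr
    exact (nnnorm_sum_le _ _).trans_eq (by simp)
  simp only [enorm_eq_nnnorm]
  exact_mod_cast h

/-- Energy of a superposition of delayed codewords. -/
lemma sum_sq_enorm_superposition_le {κ ι : Type*} {n : ℕ} (S : Finset κ) (g : κ → ℂ)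
    (x : κ → Fin n → ℂ) (E : Finset ι) (φ : κ → ι → ℤ) (hφ : ∀ ℓ, Set.InjOn (φ ℓ) E) :
    ∑ i ∈ E, ‖∑ ℓ ∈ S, g ℓ * zeroExt (x ℓ) (φ ℓ i)‖ₑ ^ 2 ≤
      (∑ ℓ ∈ S, ‖g ℓ‖ₑ ^ 2) * ∑ ℓ ∈ S, ∑ j, ‖x ℓ j‖ₑ ^ 2 := by
  calc _ ≤ ∑ i ∈ E, (∑ ℓ ∈ S, ‖g ℓ‖ₑ ^ 2) * ∑ ℓ ∈ S, ‖zeroExt (x ℓ) (φ ℓ i)‖ₑ ^ 2 :=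
        Finset.sum_le_sum fun i _ => sq_enorm_sum_mul_le S g _
    _ = (∑ ℓ ∈ S, ‖g ℓ‖ₑ ^ 2) * ∑ ℓ ∈ S, ∑ i ∈ E, ‖zeroExt (x ℓ) (φ ℓ i)‖ₑ ^ 2 := by
        rw [← Finset.mul_sum, Finset.sum_comm]
    _ ≤ _ := by
        gcongr with ℓ
        exact sum_sq_enorm_zeroExt_le (x ℓ) E (φ ℓ) (hφ ℓ)

lemma measurable_zeroExt {n : ℕ} (j : ℤ) : Measurable fun x : Fin n → ℂ => zeroExt x j := by
  unfold zeroExt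
  split_ifs
  · fun_prop
  · fun_prop

/-! ### Few outputs of bounded total energy -/

section Channel

variable {Ω 𝓧 ι : Type*} [MeasurableSpace Ω] [MeasurableSpace 𝓧] [Fintype ι] {μ : Measure Ω}
  [IsProbabilityMeasure μ] {X : Ω → 𝓧} {Z : Ω → ι → ℂ} {v : ℝ≥0} {s : ι → 𝓧 → ℂ}
  [StandardBorelSpace 𝓧] [Nonempty 𝓧]

/-- Outputs at few positions add little information if the total energy is bounded. -/
lemma mutualInfo_union_le_of_energy_le [DecidableEq ι] (hX : AEMeasurable X μ)
    (hZ : AEMeasurable Z μ) (hv : 0 < v)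
    (hlaw : μ.map (fun ω => (X ω, Z ω)) =
      (μ.map X).prod (Measure.pi fun _ => complexGaussian v))
    (hs : ∀ i, Measurable (s i)) (T E : Finset ι) (Q : ℝ≥0) {c : ℝ} (hc : E.card ≤ c)
    (hQ : ∫⁻ ω, ∑ i ∈ E, ‖s i (X ω)‖ₑ ^ 2 ∂μ ≤ Q) :
    mutualInfo X (fun ω (j : (E ∪ T : Finset ι)) => s j (X ω) + Z ω j) μ ≤
      mutualInfo X (fun ω (j : T) => s j (X ω) + Z ω j) μ +
        ENNReal.ofReal (2 * √(c * (Q / v))) := by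
  have hsum : ∫⁻ ω, ∑ i ∈ E, ‖s i (X ω)‖ₑ ^ 2 ∂μ = ∑ i ∈ E, ∫⁻ ω, ‖s i (X ω)‖ₑ ^ 2 ∂μ :=
    lintegral_finsetSum' _ fun i _ => ((hs i).comp_aemeasurable hX).enorm.pow_const 2
  rw [hsum] at hQ
  have hc0 : 0 ≤ c := (Nat.cast_nonneg _).trans hc
  have hfin (i : ι) (hi : i ∈ E) : ∫⁻ ω, ‖s i (X ω)‖ₑ ^ 2 ∂μ ≠ ∞ :=
    ((Finset.single_le_sum_of_canonicallyOrdered (f := fun i => ∫⁻ ω, ‖s i (X ω)‖ₑ ^ 2 ∂μ)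
      hi).trans hQ |>.trans_lt ENNReal.coe_lt_top).ne
  -- The power at position i, finite on `E` by the energy bound; elsewhere an infinite integral
  -- would become 0, but only positions in `E` are used.
  set q : ι → ℝ≥0 := fun i => (∫⁻ ω, ‖s i (X ω)‖ₑ ^ 2 ∂μ).toNNReal with hq_def
  have hq (i : ι) (hi : i ∈ E) : ∫⁻ ω, ‖s i (X ω)‖ₑ ^ 2 ∂μ = q i :=
    (ENNReal.coe_toNNReal (hfin i hi)).symm
  rw [Finset.sum_congr rfl hq] at hQ
  have hQ' : ∑ i ∈ E, (q i : ℝ) ≤ Q := by exact_mod_cast hQ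
  refine (mutualInfo_union_le hX hZ hv hlaw hs (q := q) T E fun i hi => (hq i hi).le).trans ?_
  gcongr
  refine (sum_log_one_add_le E (fun i => (q i : ℝ) / v) fun i => by positivity).trans ?_
  rw [← Finset.sum_div]
  gcongr

/-- All of `T` is added to the empty family of outputs, which is constant and carries no
information. -/
lemma mutualInfo_ne_top_of_energy_le [DecidableEq ι] (hX : AEMeasurable X μ)
    (hZ : AEMeasurable Z μ) (hv : 0 < v)
    (hlaw : μ.map (fun ω => (X ω, Z ω)) =
      (μ.map X).prod (Measure.pi fun _ => complexGaussian v))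
    (hs : ∀ i, Measurable (s i)) (T : Finset ι) (Q : ℝ≥0)
    (hQ : ∫⁻ ω, ∑ i ∈ T, ‖s i (X ω)‖ₑ ^ 2 ∂μ ≤ Q) :
    mutualInfo X (fun ω (j : T) => s j (X ω) + Z ω j) μ ≠ ∞ := by
  have h := mutualInfo_union_le_of_energy_le hX hZ hv hlaw hs ∅ T Q le_rfl hQ
  have h0 : (fun ω (j : (∅ : Finset ι)) => s j (X ω) + Z ω j) = fun _ _ => 0 := by
    ext ω j
    exact absurd j.2 (Finset.notMem_empty _)
  rw [h0, mutualInfo_const hX, zero_add, Finset.union_empty] at h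
  exact (h.trans_lt ENNReal.ofReal_lt_top).ne

/-- The information carried by all outputs in the range of `e`, compared with the information
carried by those in `T`. -/
lemma mutualInfo_bounds_of_energy_le [DecidableEq ι] {κ : Type*} [Countable κ]
    (hX : AEMeasurable X μ) (hZ : AEMeasurable Z μ) (hv : 0 < v)
    (hlaw : μ.map (fun ω => (X ω, Z ω)) =
      (μ.map X).prod (Measure.pi fun _ => complexGaussian v))
    (hs : ∀ i, Measurable (s i)) (T E : Finset ι) (Q : ℝ≥0) {c : ℝ} (hc : E.card ≤ c)
    (hQ : ∫⁻ ω, ∑ i ∈ E, ‖s i (X ω)‖ₑ ^ 2 ∂μ ≤ Q) {e : κ → ι}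
    (he : ∀ i, i ∈ E ∪ T ↔ ∃ k, e k = i) :
    mutualInfo X (fun ω (j : T) => s j (X ω) + Z ω j) μ ≤
        mutualInfo X (fun ω k => s (e k) (X ω) + Z ω (e k)) μ ∧
      mutualInfo X (fun ω k => s (e k) (X ω) + Z ω (e k)) μ ≤
        mutualInfo X (fun ω (j : T) => s j (X ω) + Z ω j) μ +
          ENNReal.ofReal (2 * √(c * (Q / v))) := by
  refine ⟨mutualInfo_reindex_le (Y := fun ω i => s i (X ω) + Z ω i) (e := ((↑) : T → ι)) hX
    (aemeasurable_output hX hZ hs e) fun j => (he j).1 (Finset.mem_union_right E j.2), ?_⟩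
  refine le_trans ?_ (mutualInfo_union_le_of_energy_le hX hZ hv hlaw hs T E Q hc hQ)
  exact mutualInfo_reindex_le (Y := fun ω i => s i (X ω) + Z ω i)
    (e' := ((↑) : (E ∪ T : Finset ι) → ι)) hX (aemeasurable_output hX hZ hs _)
    fun k => ⟨⟨e k, (he _).2 ⟨k, rfl⟩⟩, rfl⟩

end Channel

/-! ### Channel inputs: measurability, independence and power -/

lemma measurable_relayOutput {K n m : ℕ} {α : Type*} [MeasurableSpace α] (gR : Fin K → ℂ)
    (d : Fin (K + 1) → ℕ) {x : α → Fin K → Fin n → ℂ} {z : α → Fin m → ℂ}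
    (hx : ∀ ℓ, Measurable fun a => x a ℓ) (hz : Measurable z) (i : Fin m) :
    Measurable fun a => relayOutput gR d (x a) (z a) i := by
  unfold relayOutput
  refine (Finset.measurable_fun_sum _ fun ℓ _ => ?_).add ((measurable_pi_apply i).comp hz)
  exact ((measurable_zeroExt _).comp (hx ℓ)).const_mul _

lemma measurable_inputs {K n D : ℕ} {A : Fin K → Type*} [∀ ℓ, Fintype (A ℓ)]
    [∀ ℓ, MeasurableSpace (A ℓ)] [∀ ℓ, MeasurableSingletonClass (A ℓ)] (c : Code K n A)
    (gR : Fin K → ℂ) (d : Fin (K + 1) → ℕ) :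
    Measurable fun p : (Fin n → ∀ ℓ, A ℓ) × (Fin (n + D) → ℂ) => inputs c gR d p.1 p.2 := by
  -- Finite alphabets make the space of source blocks countable with measurable singletons, so an
  -- arbitrary encoder is measurable.
  have henc (ℓ : Fin K) : Measurable fun p : (Fin n → ∀ ℓ, A ℓ) × (Fin (n + D) → ℂ) =>
      c.enc ℓ fun i => p.1 i ℓ :=
    (measurable_of_countable fun u : Fin n → ∀ ℓ, A ℓ => c.enc ℓ fun i => u i ℓ).comp
      measurable_fst
  refine measurable_pi_iff.2 fun ℓ => ?_
  induction ℓ using Fin.lastCases with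
  | last =>
    simp only [inputs, Fin.snoc_last]
    refine measurable_pi_iff.2 fun i => (c.measurable_relay i).comp ?_
    exact measurable_pi_iff.2 fun j => measurable_relayOutput gR d henc measurable_snd _
  | cast ℓ =>
    simp only [inputs, Fin.snoc_castSucc]
    exact henc ℓ

/-- A function of the first and third of three independent variables is independent of the
second one. -/
lemma map_prodMk_eq_prod_of_map_eq {Ω α β γ δ : Type*} [MeasurableSpace Ω] [MeasurableSpace α]
    [MeasurableSpace β] [MeasurableSpace γ] [MeasurableSpace δ] {μ : Measure Ω}
    {a : Measure α} {b : Measure β} {b' : Measure γ} [IsProbabilityMeasure a]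
    [IsProbabilityMeasure b] [IsProbabilityMeasure b'] {U : Ω → α} {V : Ω → β} {W : Ω → γ}
    (hm : AEMeasurable (fun ω => (U ω, V ω, W ω)) μ)
    (hlaw : μ.map (fun ω => (U ω, V ω, W ω)) = a.prod (b.prod b')) {F : α × γ → δ}
    (hF : Measurable F) :
    μ.map (fun ω => (F (U ω, W ω), V ω)) = (μ.map fun ω => F (U ω, W ω)).prod b := by
  have e1 : μ.map (fun ω => ((U ω, W ω), V ω)) = (a.prod b').prod b := by
    have h := congrArg (Measure.map (Prod.map id Prod.swap)) hlaw
    rw [← Measure.map_prod_map _ _ measurable_id measurable_swap, Measure.map_id,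
      Measure.prod_swap, ← Measure.prodAssoc_prod,
      AEMeasurable.map_map_of_aemeasurable (by fun_prop) hm] at h
    have h' := congrArg (Measure.map MeasurableEquiv.prodAssoc.symm) h
    rw [MeasurableEquiv.map_symm_map, AEMeasurable.map_map_of_aemeasurable (by fun_prop)
      ((by fun_prop : Measurable (Prod.map id Prod.swap)).comp_aemeasurable hm)] at h'
    exact h'
  have hU : AEMeasurable U μ := measurable_fst.comp_aemeasurable hm
  have hV : AEMeasurable V μ := (measurable_fst.comp measurable_snd).comp_aemeasurable hm
  have hW : AEMeasurable W μ := (measurable_snd.comp measurable_snd).comp_aemeasurable hm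
  have hUW : AEMeasurable (fun ω => (U ω, W ω)) μ := hU.prodMk hW
  have e2 : μ.map (fun ω => (U ω, W ω)) = a.prod b' := by
    have h := congrArg Measure.fst e1
    rwa [Measure.fst_map_prodMk₀ hV, Measure.fst_prod] at h
  have h3 := congrArg (Measure.map (Prod.map F id)) e1
  rw [← Measure.map_prod_map _ _ hF measurable_id, Measure.map_id, ← e2,
    AEMeasurable.map_map_of_aemeasurable hF.aemeasurable hUW,
    AEMeasurable.map_map_of_aemeasurable (by fun_prop) (hUW.prodMk hV)] at h3
  exact h3

/-- Noiseless output, at position `i`, of the transmitters in `S` delayed according to `φ`. -/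
noncomputable def superposition {κ ι : Type*} {n : ℕ} (S : Finset κ) (g : κ → ℂ)
    (φ : κ → ι → ℤ) (i : ι) (x : S → Fin n → ℂ) : ℂ :=
  ∑ ℓ : S, g ℓ * zeroExt (x ℓ) (φ ℓ i)

lemma measurable_superposition {κ ι : Type*} {n : ℕ} (S : Finset κ) (g : κ → ℂ)
    (φ : κ → ι → ℤ) (i : ι) :
    Measurable (superposition (n := n) S g φ i) := by
  unfold superposition
  exact Finset.measurable_fun_sum _ fun ℓ _ =>
    ((measurable_zeroExt _).comp (measurable_pi_apply ℓ)).const_mul _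

lemma superposition_restrict {κ ι : Type*} {n : ℕ} (S : Finset κ) (g : κ → ℂ)
    (φ : κ → ι → ℤ) (i : ι) (x : κ → Fin n → ℂ) :
    superposition S g φ i (fun ℓ : S => x ℓ) = ∑ ℓ ∈ S, g ℓ * zeroExt (x ℓ) (φ ℓ i) :=
  Finset.sum_coe_sort S fun ℓ => g ℓ * zeroExt (x ℓ) (φ ℓ i)

/-- Expected energy of the superposition of delayed codewords, under average power
constraints. -/
lemma lintegral_sum_sq_superposition_le {Ω κ ι : Type*} [MeasurableSpace Ω] [Fintype κ]
    {μ : Measure Ω} {n : ℕ} (hn : 0 < n) {X : Ω → κ → Fin n → ℂ} (hX : AEMeasurable X μ)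
    {P : κ → ℝ≥0}
    (hP : ∀ ℓ, ∫⁻ ω, (n : ℝ≥0∞)⁻¹ * ∑ i, ‖X ω ℓ i‖ₑ ^ 2 ∂μ ≤ (P ℓ : ℝ≥0∞))
    (S : Finset κ) (g : κ → ℂ) (φ : κ → ι → ℤ) (E : Finset ι)
    (hφ : ∀ ℓ, Set.InjOn (φ ℓ) E) :
    ∫⁻ ω, ∑ i ∈ E, ‖superposition S g φ i fun ℓ : S => X ω ℓ‖ₑ ^ 2 ∂μ ≤
      ((n * ((∑ ℓ, ‖g ℓ‖₊ ^ 2) * ∑ ℓ, P ℓ) : ℝ≥0) : ℝ≥0∞) := by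
  have hn0 : (n : ℝ≥0∞) ≠ 0 := by exact_mod_cast hn.ne'
  have hm (ℓ : κ) : AEMeasurable (fun ω => ∑ i, ‖X ω ℓ i‖ₑ ^ 2) μ := by fun_prop
  have hE (ℓ : κ) : ∫⁻ ω, ∑ i, ‖X ω ℓ i‖ₑ ^ 2 ∂μ ≤ n * P ℓ := by
    have h := hP ℓ
    rw [lintegral_const_mul'' _ (hm ℓ)] at h
    calc ∫⁻ ω, ∑ i, ‖X ω ℓ i‖ₑ ^ 2 ∂μ
        = n * ((n : ℝ≥0∞)⁻¹ * ∫⁻ ω, ∑ i, ‖X ω ℓ i‖ₑ ^ 2 ∂μ) := by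
          rw [← mul_assoc, ENNReal.mul_inv_cancel hn0 (ENNReal.natCast_ne_top n), one_mul]
      _ ≤ n * P ℓ := by gcongr
  calc _ ≤ ∫⁻ ω, (∑ ℓ, ‖g ℓ‖ₑ ^ 2) * ∑ ℓ, ∑ j, ‖X ω ℓ j‖ₑ ^ 2 ∂μ := by
        refine lintegral_mono fun ω => ?_
        simp only [superposition_restrict]
        refine (sum_sq_enorm_superposition_le S g (X ω) E φ hφ).trans ?_
        -- Enlarging both sums from `S` to all transmitters makes the bound uniform in `S`.
        gcongr <;> exact Finset.subset_univ S
    _ = (∑ ℓ, ‖g ℓ‖ₑ ^ 2) * ∑ ℓ, ∫⁻ ω, ∑ j, ‖X ω ℓ j‖ₑ ^ 2 ∂μ := by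
        rw [lintegral_const_mul'' _ (Finset.aemeasurable_fun_sum _ fun ℓ _ => hm ℓ),
          lintegral_finsetSum' _ fun ℓ _ => hm ℓ]
    _ ≤ (∑ ℓ, ‖g ℓ‖ₑ ^ 2) * ∑ ℓ, n * (P ℓ : ℝ≥0∞) := by
        gcongr with ℓ
        exact hE ℓ
    _ = _ := by
        rw [← Finset.mul_sum]
        push_cast
        simp only [enorm_eq_nnnorm]
        ring

/-! ### Comparison of the linear and cyclic channels -/

/-- Two quantities in an interval [m, m + c] with m finite are finite and at most c apart; m will be
the information of the common outputs. -/
lemma abs_toReal_sub_le {a b m : ℝ≥0∞} {c : ℝ} (hc : 0 ≤ c) (hm : m ≠ ∞) (ha : m ≤ a)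
    (hb : m ≤ b) (ha' : a ≤ m + ENNReal.ofReal c) (hb' : b ≤ m + ENNReal.ofReal c) :
    a ≠ ∞ ∧ b ≠ ∞ ∧ |a.toReal - b.toReal| ≤ c := by
  have ht : m + ENNReal.ofReal c ≠ ∞ := ENNReal.add_ne_top.2 ⟨hm, ENNReal.ofReal_ne_top⟩
  have ha_top := ne_top_of_le_ne_top ht ha'
  have hb_top := ne_top_of_le_ne_top ht hb'
  have h1 := ENNReal.toReal_mono ha_top ha
  have h2 := ENNReal.toReal_mono hb_top hb
  have h3 := ENNReal.toReal_mono ht ha'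
  have h4 := ENNReal.toReal_mono ht hb'
  rw [ENNReal.toReal_add hm ENNReal.ofReal_ne_top, ENNReal.toReal_ofReal hc] at h3 h4
  exact ⟨ha_top, hb_top, abs_sub_le_iff.2 ⟨by linarith, by linarith⟩⟩

lemma card_filter_edge_le (n D : ℕ) :
    (Finset.univ.filter fun i : Fin (n + D) => (i : ℕ) < D ∨ n ≤ (i : ℕ)).card ≤ 2 * D := by
  have h : ((Finset.univ.filter fun i : Fin (n + D) => (i : ℕ) < D ∨ n ≤ (i : ℕ)).map
      Fin.valEmbedding) ⊆ Finset.range D ∪ Finset.Ico n (n + D) := by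
    intro k hk
    simp only [Finset.mem_map, Finset.mem_filter, Finset.mem_univ, true_and,
      Fin.valEmbedding_apply] at hk
    obtain ⟨i, hi, rfl⟩ := hk
    have := i.2
    simp only [Finset.mem_union, Finset.mem_range, Finset.mem_Ico]
    omega
  have h2 := (Finset.card_le_card h).trans (Finset.card_union_le _ _)
  rw [Finset.card_map] at h2
  simp only [Finset.card_range, Nat.card_Ico] at h2
  omega

/-- Time in the codeword of transmitter `ℓ` that is received at time `i`. -/
def linearShift {κ : Type*} (n D : ℕ) (d : κ → ℕ) (ℓ : κ) (i : Fin (n + D)) : ℤ :=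
  (i : ℤ) - d ℓ

/-- Time in the codeword of transmitter `ℓ` that is received at time `i` in the cyclic
channel. -/
def cyclicShift {κ : Type*} (n D : ℕ) (d : κ → ℕ) (ℓ : κ) (i : Fin (n + D)) : ℤ :=
  ((i : ℤ) - d ℓ) % n

lemma linearShift_injective {κ : Type*} {n D : ℕ} (d : κ → ℕ) (ℓ : κ) :
    Function.Injective (linearShift n D d ℓ) := fun i j h => by
  simp only [linearShift] at h
  exact Fin.ext (by omega)

/-- Two times in [0, n) that agree modulo n are equal. Beyond n the cyclic shift would repeat
symbols. -/
lemma cyclicShift_injOn {κ : Type*} {n D : ℕ} (d : κ → ℕ) (ℓ : κ) {E : Finset (Fin (n + D))}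
    (hE : ∀ i ∈ E, (i : ℕ) < n) : Set.InjOn (cyclicShift n D d ℓ) E := fun i hi j hj h => by
  have hi' := hE i hi
  have hj' := hE j hj
  have h2 := Int.emod_eq_emod_iff_emod_sub_eq_zero.1 h
  rw [sub_sub_sub_cancel_right] at h2
  have h3 := Int.eq_zero_of_abs_lt_dvd (Int.dvd_of_emod_eq_zero h2)
    (abs_sub_lt_iff.2 ⟨by omega, by omega⟩)
  exact Fin.ext (by omega)

/-- Here 0 ≤ i - d_ℓ < n, so nothing wraps around. -/
lemma cyclicShift_eq_linearShift {κ : Type*} {n D : ℕ} {d : κ → ℕ} {ℓ : κ} (hd : d ℓ ≤ D)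
    {i : Fin (n + D)} (hD : D ≤ (i : ℕ)) (hn : (i : ℕ) < n) :
    cyclicShift n D d ℓ i = linearShift n D d ℓ i :=
  Int.emod_eq_of_lt (by omega) (by omega)

section Comparison

variable {Ω κ : Type*} [MeasurableSpace Ω] [Fintype κ] {μ : Measure Ω} [IsProbabilityMeasure μ]

/-- The mutual informations of the linear and of the cyclic superposition channels differ by
little, since their outputs coincide except at the first and last `D` positions. -/
lemma abs_mutualInfo_superposition_sub_le {n D : ℕ} (hn : 0 < n) {X : Ω → κ → Fin n → ℂ}
    {Z : Ω → Fin (n + D) → ℂ} {v : ℝ≥0} (hv : 0 < v) (hX : AEMeasurable X μ)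
    (hZ : AEMeasurable Z μ)
    (hlaw : μ.map (fun ω => (X ω, Z ω)) =
      (μ.map X).prod (Measure.pi fun _ => complexGaussian v))
    {P : κ → ℝ≥0}
    (hP : ∀ ℓ, ∫⁻ ω, (n : ℝ≥0∞)⁻¹ * ∑ i, ‖X ω ℓ i‖ₑ ^ 2 ∂μ ≤ (P ℓ : ℝ≥0∞))
    (S : Finset κ) (g : κ → ℂ) {d : κ → ℕ} (hd : ∀ ℓ, d ℓ ≤ D) {I I' : ℝ≥0∞}
    (hI : I = mutualInfo (fun ω (ℓ : S) => X ω ℓ) (fun ω (i : Fin (n + D)) =>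
      superposition S g (linearShift n D d) i (fun ℓ : S => X ω ℓ) + Z ω i) μ)
    (hI' : I' = mutualInfo (fun ω (ℓ : S) => X ω ℓ) (fun ω (i : Fin n) =>
      superposition S g (cyclicShift n D d) (i.castAdd D) (fun ℓ : S => X ω ℓ) +
        Z ω (i.castAdd D)) μ) :
    I ≠ ∞ ∧ I' ≠ ∞ ∧ |I.toReal - I'.toReal| ≤
      2 * √(2 * D * ((n * ((∑ ℓ, ‖g ℓ‖₊ ^ 2) * ∑ ℓ, P ℓ) : ℝ≥0) / v)) := by
  have hR : Measurable fun (x : κ → Fin n → ℂ) (ℓ : S) => x ℓ :=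
    measurable_pi_iff.2 fun ℓ => measurable_pi_apply (ℓ : κ)
  have hXS : AEMeasurable (fun ω (ℓ : S) => X ω ℓ) μ := hR.comp_aemeasurable hX
  have hlawS : μ.map (fun ω => ((fun ℓ : S => X ω ℓ), Z ω)) =
      (μ.map fun ω (ℓ : S) => X ω ℓ).prod (Measure.pi fun _ => complexGaussian v) := by
    have := Measure.isProbabilityMeasure_map hX
    have h := congrArg (Measure.map (Prod.map (fun (x : κ → Fin n → ℂ) (ℓ : S) => x ℓ) id)) hlaw
    rw [← Measure.map_prod_map _ _ hR measurable_id, Measure.map_id,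
      AEMeasurable.map_map_of_aemeasurable hR.aemeasurable hX,
      AEMeasurable.map_map_of_aemeasurable (by fun_prop) (hX.prodMk hZ)] at h
    exact h
  -- `T` holds the common positions, `E` the other positions of the linear channel, `F` those of the
  -- cyclic one. If n ≤ D then `T` is empty and the argument is unchanged.
  obtain ⟨T, hT⟩ : ∃ T : Finset (Fin (n + D)), ∀ i, i ∈ T ↔ D ≤ (i : ℕ) ∧ (i : ℕ) < n :=
    ⟨Finset.univ.filter fun i => D ≤ (i : ℕ) ∧ (i : ℕ) < n, by simp⟩
  obtain ⟨E, hE, hcE⟩ : ∃ E : Finset (Fin (n + D)),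
      (∀ i, i ∈ E ↔ (i : ℕ) < D ∨ n ≤ (i : ℕ)) ∧ E.card ≤ 2 * D :=
    ⟨Finset.univ.filter fun i => (i : ℕ) < D ∨ n ≤ (i : ℕ), by simp, card_filter_edge_le n D⟩
  obtain ⟨F, hF⟩ : ∃ F : Finset (Fin (n + D)), ∀ i, i ∈ F ↔ (i : ℕ) < D ∧ (i : ℕ) < n :=
    ⟨Finset.univ.filter fun i => (i : ℕ) < D ∧ (i : ℕ) < n, by simp⟩
  have hET (i : Fin (n + D)) : i ∈ E ∪ T ↔ ∃ k, id k = i := by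
    simp only [Finset.mem_union, hE, hT, id, exists_eq, iff_true]
    omega
  have hFT (i : Fin (n + D)) : i ∈ F ∪ T ↔ ∃ k : Fin n, k.castAdd D = i := by
    simp only [Finset.mem_union, hF, hT]
    constructor
    · intro h
      exact ⟨⟨i, by omega⟩, rfl⟩
    · rintro ⟨k, rfl⟩
      have := k.2
      simp only [Fin.val_castAdd]
      omega
  have hcE' : (E.card : ℝ) ≤ 2 * D := by exact_mod_cast hcE
  have hcF : (F.card : ℝ) ≤ 2 * D := by
    refine le_trans ?_ hcE'
    exact_mod_cast Finset.card_le_card fun i hi => (hE i).2 (Or.inl ((hF i).1 hi).1)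
  have hsame : (fun ω (j : T) =>
        superposition S g (cyclicShift n D d) j (fun ℓ : S => X ω ℓ) + Z ω j) =
      fun ω (j : T) =>
        superposition S g (linearShift n D d) j (fun ℓ : S => X ω ℓ) + Z ω j := by
    ext ω j
    have hj := (hT j).1 j.2
    congr 1
    refine Finset.sum_congr rfl fun ℓ _ => ?_
    rw [cyclicShift_eq_linearShift (hd ℓ) hj.1 hj.2]
  have hφm (i) := measurable_superposition (n := n) S g (linearShift n D d) i
  have hψm (i) := measurable_superposition (n := n) S g (cyclicShift n D d) i
  have hfin := mutualInfo_ne_top_of_energy_le hXS hZ hv hlawS hφm T _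
    (lintegral_sum_sq_superposition_le hn hX hP S g _ T fun ℓ =>
      (linearShift_injective d ℓ).injOn)
  have h1 := mutualInfo_bounds_of_energy_le hXS hZ hv hlawS hφm T E _ hcE'
    (lintegral_sum_sq_superposition_le hn hX hP S g _ E fun ℓ =>
      (linearShift_injective d ℓ).injOn) hET
  have h2 := mutualInfo_bounds_of_energy_le hXS hZ hv hlawS hψm T F _ hcF
    (lintegral_sum_sq_superposition_le hn hX hP S g _ F fun ℓ =>
      cyclicShift_injOn d ℓ fun i hi => ((hF i).1 hi).2) hFT
  rw [hsame] at h2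
  simp only [id] at h1
  rw [← hI] at h1
  rw [← hI'] at h2
  exact abs_toReal_sub_le (by positivity) hfin h1.1 h2.1 h1.2 h2.2

end Comparison

/-! ### Specialisation to the relay channel -/

lemma slicedOutput_eq_superposition {K n D : ℕ} (gD : Fin (K + 1) → ℂ)
    (S : Finset (Fin (K + 1))) (d : Fin (K + 1) → ℕ) (x : Fin (K + 1) → Fin n → ℂ)
    (zD : Fin (n + D) → ℂ) :
    slicedOutput gD S d x zD =
      fun i => superposition S gD (linearShift n D d) i (fun ℓ : S => x ℓ) + zD i := by
  ext i
  rw [superposition_restrict]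
  rfl

lemma cyclicOutput_eq_superposition {K n D : ℕ} (gD : Fin (K + 1) → ℂ)
    (S : Finset (Fin (K + 1))) (d : Fin (K + 1) → ℕ) (x : Fin (K + 1) → Fin n → ℂ)
    (zD : Fin (n + D) → ℂ) :
    cyclicOutput gD S d x zD = fun i =>
      superposition S gD (cyclicShift n D d) (i.castAdd D) (fun ℓ : S => x ℓ) +
        zD (i.castAdd D) := by
  ext i
  rw [superposition_restrict]
  rfl

end TAMARC

theorem lemma1 (K : ℕ) (gD : Fin (K + 1) → ℂ) (gR : Fin K → ℂ) (N : ℝ≥0) (hN : 0 < N)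
    (P : Fin (K + 1) → ℝ≥0) (dmax : ℕ → ℕ) :
    ∃ ε : ℕ → ℝ,
      (Tendsto (fun n : ℕ => (dmax n : ℝ) / (n : ℝ)) atTop (𝓝 0) → Tendsto ε atTop (𝓝 0)) ∧
      ∀ (n : ℕ), 0 < n →
      -- the source, the codebook, and the random variables
      ∀ (A : Fin K → Type*) [∀ ℓ, Fintype (A ℓ)] [∀ ℓ, MeasurableSpace (A ℓ)]
        [∀ ℓ, MeasurableSingletonClass (A ℓ)] (p : PMF (∀ ℓ, A ℓ)) (c : TAMARC.Code K n A)
        (Ω : Type*) [MeasurableSpace Ω] (μ : Measure Ω) [IsProbabilityMeasure μ]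
        (U : Ω → Fin n → ∀ ℓ, A ℓ) (ZD ZR : Ω → Fin (n + dmax n) → ℂ),
        HasLaw (fun ω => (U ω, ZD ω, ZR ω)) (TAMARC.blockLaw p N n (n + dmax n)) μ →
      ∀ d : Fin (K + 1) → ℕ, (∀ ℓ, d ℓ ≤ dmax n) →
      -- the channel inputs satisfy the power constraints
      ∀ X : Ω → Fin (K + 1) → Fin n → ℂ,
        X = (fun ω => TAMARC.inputs c gR d (U ω) (ZR ω)) →
        (∀ ℓ, ∫⁻ ω, (n : ℝ≥0∞)⁻¹ * ∑ i, ‖X ω ℓ i‖ₑ ^ 2 ∂μ ≤ (P ℓ : ℝ≥0∞)) →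
      ∀ S : Finset (Fin (K + 1)),
      ∀ I I' : ℝ≥0∞,
        I = TAMARC.mutualInfo (fun ω (ℓ : S) => X ω ℓ)
          (fun ω => TAMARC.slicedOutput gD S d (X ω) (ZD ω)) μ →
        I' = TAMARC.mutualInfo (fun ω (ℓ : S) => X ω ℓ)
          (fun ω => TAMARC.cyclicOutput gD S d (X ω) (ZD ω)) μ →
        I ≠ ∞ ∧ I' ≠ ∞ ∧ 1 / (n : ℝ) * |I.toReal - I'.toReal| ≤ ε n := by
  set C : ℝ≥0 := (∑ ℓ, ‖gD ℓ‖₊ ^ 2) * ∑ ℓ, P ℓ with hC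
  -- This is 2√(2D·nC/N)/n with n moved under the root.
  refine ⟨fun n => 2 * √(2 * ((dmax n : ℝ) / n) * (C / N)), fun h => ?_, ?_⟩
  · have h1 : Tendsto (fun n : ℕ => 2 * √(2 * ((dmax n : ℝ) / n) * (C / N))) atTop
        (𝓝 (2 * √(2 * 0 * (C / N)))) :=
      (((h.const_mul 2).mul_const _).sqrt).const_mul 2
    simpa using h1
  intro n hn A _ _ _ p c Ω _ μ _ U ZD ZR hlaw d hd X hX hP S I I' hI hI'
  have hm := hlaw.aemeasurable
  have hF := TAMARC.measurable_inputs (D := dmax n) c gR d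
  have hZD : AEMeasurable ZD μ := (measurable_fst.comp measurable_snd).comp_aemeasurable hm
  have hU : AEMeasurable U μ := measurable_fst.comp_aemeasurable hm
  have hZR : AEMeasurable ZR μ := (measurable_snd.comp measurable_snd).comp_aemeasurable hm
  have hXm : AEMeasurable X μ := by
    have h := hF.comp_aemeasurable (hU.prodMk hZR)
    rw [hX]
    exact h
  have hl := hlaw.map_eq
  rw [TAMARC.blockLaw] at hl
  have hXZ : μ.map (fun ω => (X ω, ZD ω)) =
      (μ.map X).prod (Measure.pi fun _ => TAMARC.complexGaussian N) := by
    -- The inputs depend on the sources and the relay noise only, hence are independent of the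
    -- destination noise.
    have h := TAMARC.map_prodMk_eq_prod_of_map_eq hm hl hF
    rw [hX]
    exact h
  simp only [TAMARC.slicedOutput_eq_superposition] at hI
  simp only [TAMARC.cyclicOutput_eq_superposition] at hI'
  obtain ⟨h1, h2, h3⟩ :=
    TAMARC.abs_mutualInfo_superposition_sub_le hn hN hXm hZD hXZ hP S gD hd hI hI'
  refine ⟨h1, h2, (mul_le_mul_of_nonneg_left h3 (by positivity)).trans_eq ?_⟩
  have hn' : (0 : ℝ) < n := by exact_mod_cast hn
  -- Since D·n = n²·(D/n), a factor n leaves the root and cancels 1/n.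
  have e : 2 * (dmax n : ℝ) * ((n * C : ℝ≥0) / N) =
      (n : ℝ) ^ 2 * (2 * ((dmax n : ℝ) / n) * (C / N)) := by
    push_cast
    field_simp
  rw [← hC, e, Real.sqrt_mul (by positivity), Real.sqrt_sq hn'.le]
  field_simp
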